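/- Let $p\ge 1$, let $N=\mathrm{diag}(n_1,\dots,n_p)$ with all $n_j>0$ and $N^{1/2}=\mathrm{diag}(\sqrt{n_1},\dots,\sqrt{n_p})$, let $S$ be a real symmetric positive definite $p\times p$ matrix, and let $v\in\mathbb{R}$ satisfy $2v+\mathrm{tr}(N)/p>2p$. Write $|\cdot|$ for the determinant, $\mathrm{etr}(A)=\exp(\mathrm{tr}\,A)$, and $\Omega$ for the cone of real symmetric positive definite $p\times p$ matrices, equipped with Lebesgue measure $d\Sigma=\prod_{i\le j}d\sigma_{ij}$. Then, for a suitable constant $c>0$ not depending on $\Sigma$, the function $$p(\Sigma)=c\,|\Sigma|^{-\{v+\mathrm{tr}(N)/(2p)\}}\,\mathrm{etr}\left(-\tfrac12 N^{1/2}SN^{1/2}\Sigma^{-1}\right),\qquad \Sigma\in\Omega,$$ is a probability density on $\Omega$ with respect to $d\Sigma$: it is nonnegative, integrable, and $\int_\Omega p(\Sigma)\,d\Sigma=1$. Explicitly, with $m=2v+\mathrm{tr}(N)/p-p-1$, $$c=\frac{|S|^{m/2}\left(\prod_{j=1}^p n_j\right)^{m/2}}{2^{mp/2}\,\Gamma_p(m/2)},\qquad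 \Gamma_p(a)=\pi^{p(p-1)/4}\prod_{j=1}^p\Gamma\left(a-\tfrac{j-1}{2}\right).$$ -/

import Mathlib

/-- Indices `(i, j)` with `i ≤ j`: the free entries of a symmetric `p × p` matrix. -/
abbrev UpperIdx (p : ℕ) : Type := {ij : Fin p × Fin p // ij.1 ≤ ij.2}

/-- The symmetric matrix with the given entries on and above the diagonal. -/
def symMatrix {p : ℕ} (x : UpperIdx p → ℝ) : Matrix (Fin p) (Fin p) ℝ :=
  Matrix.of fun i j => x ⟨(min i j, max i j), min_le_max⟩

theorem symMatrix_isSymm {p : ℕ} (x : UpperIdx p → ℝ) : (symMatrix x).IsSymm := by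
  ext i j
  simp [symMatrix, min_comm, max_comm]

/-- Each symmetric matrix has exactly one vector of coordinates. -/
theorem existsUnique_symMatrix {p : ℕ} (A : Matrix (Fin p) (Fin p) ℝ) (hA : A.IsSymm) :
    ∃! x : UpperIdx p → ℝ, symMatrix x = A := by
  refine ⟨fun ij => A ij.1.1 ij.1.2, ?_, ?_⟩
  · ext i j
    rcases le_total i j with h | h
    · simp [symMatrix, h]
    · simpa [symMatrix, h] using hA.apply i j
  · rintro y rfl
    ext ⟨⟨i, j⟩, h⟩
    have h' : i ≤ j := h
    simp [symMatrix, h']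

/-- The cone `Ω` of positive definite matrices, in the coordinates `σ i j` with `i ≤ j`. -/
def posDefCoords (p : ℕ) : Set (UpperIdx p → ℝ) := {x | (symMatrix x).PosDef}

/-- `f` is a probability density on the cone of positive definite `p × p` matrices with respect
to Lebesgue measure `dΣ = ∏_{i ≤ j} dσ i j`. -/
structure IsPosDefDensity {p : ℕ} (f : Matrix (Fin p) (Fin p) ℝ → ℝ) : Prop where
  nonneg : ∀ A : Matrix (Fin p) (Fin p) ℝ, A.PosDef → 0 ≤ f A
  integrable : MeasureTheory.IntegrableOn (fun x => f (symMatrix x)) (posDefCoords p)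
    MeasureTheory.volume
  integral_eq_one : ∫ x in posDefCoords p, f (symMatrix x) = 1

/-- The exponential of the trace. -/
noncomputable def etr {p : ℕ} (A : Matrix (Fin p) (Fin p) ℝ) : ℝ := Real.exp A.trace

/-- The multivariate gamma function
`Γ_p(a) = π ^ (p (p - 1) / 4) ∏_{j = 1}^p Γ(a - (j - 1) / 2)`, for `a > (p - 1) / 2`. -/
noncomputable def multivariateGamma (p : ℕ) (a : ℝ) : ℝ :=
  Real.pi ^ ((p : ℝ) * ((p : ℝ) - 1) / 4) * ∏ j : Fin p, Real.Gamma (a - ((j : ℕ) : ℝ) / 2)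

/-- `N ^ (1/2)` for `N = diag(n_1, …, n_p)`. -/
noncomputable def diagSqrt {p : ℕ} (n : Fin p → ℝ) : Matrix (Fin p) (Fin p) ℝ :=
  Matrix.diagonal fun i => √(n i)

theorem diagSqrt_mul_self {p : ℕ} (n : Fin p → ℝ) (hn : ∀ i, 0 < n i) :
    diagSqrt n * diagSqrt n = Matrix.diagonal n := by
  simp [diagSqrt, Matrix.diagonal_mul_diagonal, fun i => Real.mul_self_sqrt (hn i).le]

/-- `|Σ| ^ (-(v + tr N / (2p))) etr(-½ N^{1/2} S N^{1/2} Σ⁻¹)`, where `N = diag(n_1, …, n_p)`. -/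
noncomputable def miwKernel {p : ℕ} (S : Matrix (Fin p) (Fin p) ℝ) (n : Fin p → ℝ) (v : ℝ)
    (A : Matrix (Fin p) (Fin p) ℝ) : ℝ :=
  A.det ^ (-(v + (Matrix.diagonal n).trace / (2 * (p : ℝ)))) *
    etr (-(1 / 2 : ℝ) • (diagSqrt n * S * diagSqrt n * A⁻¹))

/-- The normalizing constant of the modified inverted Wishart density:
with `m = 2v + tr N / p - p - 1`, it is
`|S|^{m/2} (∏ n_j)^{m/2} / (2^{mp/2} Γ_p(m/2))`. -/
noncomputable def miwConst {p : ℕ} (S : Matrix (Fin p) (Fin p) ℝ) (n : Fin p → ℝ) (v : ℝ) : ℝ :=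
  let m : ℝ := 2 * v + (Matrix.diagonal n).trace / (p : ℝ) - (p : ℝ) - 1
  (2 ^ (m * (p : ℝ) / 2) * multivariateGamma p (m / 2))⁻¹ * S.det ^ (m / 2) *
    (∏ j, n j) ^ (m / 2)

/-! The density is the inverse Wishart one with scale `B = N^{1/2} S N^{1/2}`: the power of `|Σ|` is
`-(m + p + 1)/2`, the condition on `v` says `m > p - 1`, and `|B| = |S| ∏ n_j`. So everything rests
on the normalizing integral `setLIntegral_inverseWishartKernel`, proved by induction on the size.

A positive definite matrix of size `p + 1` is given by its lower block `C`, a vector `w` with first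
column `C w`, and its Schur complement `t > 0`. The volume element is `|C| dC dw dt`
(`setLIntegral_posDefCoords_succ`) and the determinant is `t |C|`. With `B` written likewise as `(b,
w₀, D)`, the trace splits into a `(t, w)` part and `tr(D C⁻¹)`
(`trace_schurMatrix_mul_inv_schurMatrix`). The integral over `w` is Gaussian, that over `t` is
inverse gamma, and what remains is the same integral in `C` with `D` for `B` and `m - 1` for `m`. -/

open Matrix MeasureTheory

/-! ### Bordered matrices -/

/-- The matrix with corner entry `a`, first row `r`, first column `c` and remaining block `M`. -/
def border {p : ℕ} (a : ℝ) (r c : Fin p → ℝ) (M : Matrix (Fin p) (Fin p) ℝ) :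
    Matrix (Fin (p + 1)) (Fin (p + 1)) ℝ :=
  Matrix.of (Fin.cons (Fin.cons a r) fun i => Fin.cons (c i) (M i))

section border

variable {p : ℕ} (a : ℝ) (r c : Fin p → ℝ) (M : Matrix (Fin p) (Fin p) ℝ)

@[simp] theorem border_zero_zero : border a r c M 0 0 = a := rfl

@[simp] theorem border_zero_succ (j : Fin p) : border a r c M 0 j.succ = r j := rfl

@[simp] theorem border_succ_zero (i : Fin p) : border a r c M i.succ 0 = c i := rfl

@[simp] theorem border_succ_succ (i j : Fin p) : border a r c M i.succ j.succ = M i j := rfl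

theorem border_mul_border (a' : ℝ) (r' c' : Fin p → ℝ) (M' : Matrix (Fin p) (Fin p) ℝ) :
    border a r c M * border a' r' c' M' =
      border (a * a' + r ⬝ᵥ c') (a • r' + r ᵥ* M') (a' • c + M *ᵥ c')
        (vecMulVec c r' + M * M') := by
  ext i j
  refine Fin.cases ?_ (fun i => ?_) i <;> refine Fin.cases ?_ (fun j => ?_) j <;>
    simp [Matrix.mul_apply, Fin.sum_univ_succ, dotProduct, vecMul, mulVec, vecMulVec_apply,
      mul_comm]

theorem border_one : border 1 0 0 (1 : Matrix (Fin p) (Fin p) ℝ) = 1 := by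
  ext i j
  refine Fin.cases ?_ (fun i => ?_) i <;> refine Fin.cases ?_ (fun j => ?_) j <;>
    simp [Matrix.one_apply, Fin.succ_ne_zero, (Fin.succ_ne_zero _).symm]

theorem transpose_border : (border a r c M)ᵀ = border a c r Mᵀ := by
  ext i j
  refine Fin.cases ?_ (fun i => ?_) i <;> refine Fin.cases ?_ (fun j => ?_) j <;> simp

theorem trace_border : (border a r c M).trace = a + M.trace := by
  simp [Matrix.trace, Fin.sum_univ_succ]

theorem det_border_zero_left : (border a r 0 M).det = a * M.det := by
  rw [Matrix.det_succ_column_zero]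
  simp only [Fin.sum_univ_succ, border_zero_zero, border_succ_zero, Pi.zero_apply]
  simp
  left
  congr 1

end border

/-! ### Schur complement coordinates -/

section schurMatrix

variable {p : ℕ} (t : ℝ) (w : Fin p → ℝ) {C : Matrix (Fin p) (Fin p) ℝ}

/-- The symmetric matrix with lower block `C` whose Schur complement with respect to that block
is `t`, and whose first column below the diagonal is `C w`. -/
def schurMatrix {p : ℕ} (t : ℝ) (w : Fin p → ℝ) (C : Matrix (Fin p) (Fin p) ℝ) :
    Matrix (Fin (p + 1)) (Fin (p + 1)) ℝ :=
  border (t + w ⬝ᵥ C *ᵥ w) (C *ᵥ w) (C *ᵥ w) C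

theorem vecMul_of_isSymm (hC : C.IsSymm) : w ᵥ* C = C *ᵥ w := by
  rw [← vecMul_transpose, hC.eq]

/-- Block elimination by a unipotent factor; determinant and definiteness can then be read off the
block diagonal middle factor. -/
theorem schurMatrix_eq_mul (hC : C.IsSymm) :
    schurMatrix t w C = border 1 w 0 1 * border t 0 0 C * (border 1 w 0 1)ᵀ := by
  simp [transpose_border, border_mul_border, schurMatrix, vecMul_of_isSymm w hC,
    dotProduct_comm w]

theorem det_schurMatrix (hC : C.IsSymm) : (schurMatrix t w C).det = t * C.det := by
  simp [schurMatrix_eq_mul t w hC, det_border_zero_left]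

theorem posDef_border_zero_iff : (border t 0 0 C).PosDef ↔ 0 < t ∧ C.PosDef := by
  constructor
  · intro h
    exact ⟨h.diag_pos (i := 0), h.submatrix (Fin.succ_injective p)⟩
  · rintro ⟨ht, hC⟩
    refine PosDef.of_dotProduct_mulVec_pos ?_ fun x hx => ?_
    · have h := hC.isHermitian
      rw [IsHermitian, conjTranspose_eq_transpose_of_trivial] at h ⊢
      rw [transpose_border, h]
    · have key : star x ⬝ᵥ border t 0 0 C *ᵥ x =
          t * x 0 ^ 2 + Fin.tail x ⬝ᵥ C *ᵥ Fin.tail x := by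
        simp [dotProduct, mulVec, Fin.sum_univ_succ, Fin.tail]
        ring
      rw [key]
      by_cases h : Fin.tail x = 0
      · have hx0 : x 0 ≠ 0 := by
          intro h0
          apply hx
          ext i
          refine Fin.cases h0 (fun i => congrFun h i) i
        rw [h]
        simp
        positivity
      · have := hC.dotProduct_mulVec_pos h
        simp only [star_trivial] at this
        positivity

theorem posDef_schurMatrix_iff (hC : C.IsSymm) :
    (schurMatrix t w C).PosDef ↔ 0 < t ∧ C.PosDef := by
  have hU : IsUnit (border 1 w 0 1) := by
    rw [Matrix.isUnit_iff_isUnit_det]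
    simp [det_border_zero_left]
  rw [schurMatrix_eq_mul t w hC, ← conjTranspose_eq_transpose_of_trivial, ← star_eq_conjTranspose,
    Matrix.IsUnit.posDef_star_right_conjugate_iff hU, posDef_border_zero_iff]

theorem inv_schurMatrix (hC : C.IsSymm) (ht : t ≠ 0) (hdet : IsUnit C.det) :
    (schurMatrix t w C)⁻¹ =
      border t⁻¹ (-t⁻¹ • w) (-t⁻¹ • w) (C⁻¹ + t⁻¹ • vecMulVec w w) := by
  refine Matrix.inv_eq_right_inv ?_
  rw [schurMatrix, border_mul_border, ← border_one]
  congr 1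
  · simp [dotProduct_comm _ w]
    field_simp
    ring
  · rw [vecMul_add, ← vecMul_of_isSymm w hC, vecMul_vecMul, mul_nonsing_inv _ hdet, vecMul_smul]
    ext i
    simp [vecMul_vecMulVec, dotProduct_comm w]
    field_simp
    ring
  · simp [mulVec_neg, mulVec_smul]
  · rw [mul_add, mul_nonsing_inv _ hdet, Matrix.mul_smul, mul_vecMulVec]
    ext i j
    simp [vecMulVec_apply]

/-- Completing the square in `w`; putting both matrices in Schur form makes the centre exactly `w₀`.
-/
theorem trace_schurMatrix_mul_inv_schurMatrix (hC : C.IsSymm) (ht : t ≠ 0) (hdet : IsUnit C.det)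
    (b : ℝ) (w₀ : Fin p → ℝ) {D : Matrix (Fin p) (Fin p) ℝ} (hD : D.IsSymm) :
    (schurMatrix b w₀ D * (schurMatrix t w C)⁻¹).trace =
      t⁻¹ * (b + (w - w₀) ⬝ᵥ D *ᵥ (w - w₀)) + (D * C⁻¹).trace := by
  have h : w₀ ⬝ᵥ D *ᵥ w = w ⬝ᵥ D *ᵥ w₀ := by
    rw [dotProduct_mulVec, vecMul_of_isSymm _ hD, dotProduct_comm]
  rw [inv_schurMatrix t w hC ht hdet, schurMatrix, border_mul_border, trace_border]
  simp [mul_add, trace_vecMulVec, mul_vecMulVec, mulVec_sub, h, dotProduct_comm _ w]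
  ring

theorem Matrix.PosDef.isSymm {B : Matrix (Fin p) (Fin p) ℝ} (hB : B.PosDef) : B.IsSymm := by
  have h := hB.isHermitian
  rwa [IsHermitian, conjTranspose_eq_transpose_of_trivial] at h

theorem exists_eq_schurMatrix {B : Matrix (Fin (p + 1)) (Fin (p + 1)) ℝ} (hB : B.PosDef) :
    ∃ (b : ℝ) (w : Fin p → ℝ) (D : Matrix (Fin p) (Fin p) ℝ),
      0 < b ∧ D.PosDef ∧ B = schurMatrix b w D := by
  set D := B.submatrix Fin.succ Fin.succ with hDdef
  have hD : D.PosDef := hB.submatrix (Fin.succ_injective p)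
  set w := D⁻¹ *ᵥ fun i => B i.succ 0
  have hw : D *ᵥ w = fun i => B i.succ 0 := by
    rw [mulVec_mulVec, mul_nonsing_inv _ hD.det_pos.ne'.isUnit, one_mulVec]
  have hBD : B = schurMatrix (B 0 0 - w ⬝ᵥ D *ᵥ w) w D := by
    ext i j
    refine Fin.cases ?_ (fun i => ?_) i <;> refine Fin.cases ?_ (fun j => ?_) j <;>
      simp only [schurMatrix, hw, border_zero_zero, border_zero_succ, border_succ_zero,
        border_succ_succ, sub_add_cancel]
    · exact hB.isSymm.apply _ _
    · rfl
  refine ⟨_, w, D, ?_, hD, hBD⟩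
  rw [hBD] at hB
  exact ((posDef_schurMatrix_iff _ _ hD.isSymm).1 hB).1

end schurMatrix

/-! ### Lebesgue measure on symmetric matrices -/

section coordinates

variable {p : ℕ}

@[simp] theorem symMatrix_apply_of_le (x : UpperIdx p → ℝ) {i j : Fin p} (h : i ≤ j) :
    symMatrix x i j = x ⟨(i, j), h⟩ := by
  simp [symMatrix, h]

/-- The entries on and above the diagonal of a matrix. -/
def upperEntries (A : Matrix (Fin p) (Fin p) ℝ) : UpperIdx p → ℝ := fun ij => A ij.1.1 ij.1.2

theorem symMatrix_upperEntries {A : Matrix (Fin p) (Fin p) ℝ} (hA : A.IsSymm) :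
    symMatrix (upperEntries A) = A := by
  ext i j
  rcases le_total i j with h | h
  · simp [upperEntries, h]
  · rw [← (symMatrix_isSymm _).apply, symMatrix_apply_of_le _ h]
    exact hA.apply _ _

/-- The free entries of a symmetric matrix of size `p + 1` are those of its lower block, the
remaining entries of its first row, and its corner. -/
noncomputable def upperIdxSuccEquiv (p : ℕ) : UpperIdx p ⊕ (Fin p ⊕ Unit) ≃ UpperIdx (p + 1) :=
  Equiv.ofBijective
    (Sum.elim (fun ij => ⟨(ij.1.1.succ, ij.1.2.succ), Fin.succ_le_succ_iff.2 ij.2⟩)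
      (Sum.elim (fun j => ⟨(0, j.succ), Fin.zero_le _⟩) fun _ => ⟨(0, 0), le_rfl⟩)) <| by
    constructor
    · rintro (⟨⟨i, j⟩, h⟩ | j | _) (⟨⟨i', j'⟩, h'⟩ | j' | _) <;>
        simp [Fin.succ_ne_zero, (Fin.succ_ne_zero _).symm]
    · rintro ⟨⟨i, j⟩, h⟩
      induction i using Fin.cases with
      | zero =>
        induction j using Fin.cases with
        | zero => exact ⟨.inr (.inr ()), rfl⟩
        | succ j => exact ⟨.inr (.inl j), rfl⟩
      | succ i =>
        induction j using Fin.cases with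
        | zero => exact absurd h (by simp)
        | succ j => exact ⟨.inl ⟨(i, j), Fin.succ_le_succ_iff.1 h⟩, rfl⟩

/-- The map only regroups and relabels coordinates. -/
theorem measurePreserving_upperEntries_border (p : ℕ) :
    MeasurePreserving (fun z : (UpperIdx p → ℝ) × (Fin p → ℝ) × ℝ =>
      upperEntries (border z.2.2 z.2.1 z.2.1 (symMatrix z.1))) volume volume := by
  have h := (volume_measurePreserving_piCongrLeft (fun _ => ℝ) (upperIdxSuccEquiv p)).comp
    ((volume_measurePreserving_sumPiEquivProdPi_symm fun _ => ℝ).comp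
      ((MeasurePreserving.id volume).prod
        ((volume_measurePreserving_sumPiEquivProdPi_symm fun _ => ℝ).comp
          ((MeasurePreserving.id volume).prod (volume_preserving_funUnique Unit ℝ).symm))))
  refine (congrArg (fun g => MeasurePreserving g volume volume) ?_).mpr h
  funext ⟨y, b, s⟩
  ext ij
  obtain ⟨k, rfl⟩ := (upperIdxSuccEquiv p).surjective ij
  simp only [Function.comp_apply, MeasurableEquiv.piCongrLeft_apply_apply]
  rcases k with (⟨⟨i, j⟩, h⟩ | j | _)
  · exact symMatrix_apply_of_le y h
  · rfl
  · rfl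

theorem lintegral_upperIdx_succ {f : (UpperIdx (p + 1) → ℝ) → ENNReal} (hf : Measurable f) :
    ∫⁻ x, f x = ∫⁻ y : UpperIdx p → ℝ, ∫⁻ b : Fin p → ℝ, ∫⁻ s : ℝ,
      f (upperEntries (border s b b (symMatrix y))) := by
  have h := measurePreserving_upperEntries_border p
  rw [← h.lintegral_comp hf]
  refine (lintegral_prod _ (hf.comp h.measurable).aemeasurable).trans ?_
  refine lintegral_congr fun y => ?_
  exact lintegral_prod _ ((hf.comp h.measurable).comp measurable_prodMk_left).aemeasurable

theorem continuous_symMatrix : Continuous (symMatrix : (UpperIdx p → ℝ) → _) :=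
  continuous_matrix fun _ _ => continuous_apply _

theorem symMatrix_upperEntries_border (y : UpperIdx p → ℝ) (b : Fin p → ℝ) (s : ℝ) :
    symMatrix (upperEntries (border s b b (symMatrix y))) = border s b b (symMatrix y) :=
  symMatrix_upperEntries (by rw [IsSymm, transpose_border, symMatrix_isSymm y])

/-- An invertible linear map is a measurable embedding, so `f` may be arbitrary. -/
theorem lintegral_mulVec {ι : Type*} [Fintype ι] [DecidableEq ι] {M : Matrix ι ι ℝ}
    (hM : M.det ≠ 0) (f : (ι → ℝ) → ENNReal) :
    ∫⁻ b, f b = ENNReal.ofReal |M.det| * ∫⁻ w, f (M *ᵥ w) := by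
  have hinj : Function.Injective (toLin' M) := by
    have : IsUnit M := (Matrix.isUnit_iff_isUnit_det M).2 hM.isUnit
    exact Matrix.mulVec_injective_of_isUnit this
  have hemb : MeasurableEmbedding (toLin' M) :=
    (LinearMap.continuous_of_finiteDimensional _).measurableEmbedding hinj
  have h := hemb.lintegral_map (μ := volume) f
  rw [Real.map_matrix_volume_pi_eq_smul_volume_pi hM, lintegral_smul_measure] at h
  simp only [toLin'_apply] at h
  rw [← h, smul_eq_mul, ← mul_assoc, ← ENNReal.ofReal_mul (abs_nonneg _), ← abs_mul,
    mul_inv_cancel₀ hM, abs_one, ENNReal.ofReal_one, one_mul]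

/-- Positive definite means positive semidefinite (a closed condition) and nonsingular (an open
one). -/
theorem measurableSet_posDefCoords : MeasurableSet (posDefCoords p) := by
  have h : posDefCoords p =
      (⋂ v : Fin p → ℝ, {x | 0 ≤ v ⬝ᵥ symMatrix x *ᵥ v}) ∩ {x | (symMatrix x).det ≠ 0} := by
    ext x
    have hx : (symMatrix x).IsHermitian := by
      rw [IsHermitian, conjTranspose_eq_transpose_of_trivial, symMatrix_isSymm x]
    simp only [posDefCoords, Set.mem_ofPred_eq, Set.mem_inter_iff, Set.mem_iInter]
    constructor
    · intro h
      exact ⟨fun v => by simpa using h.posSemidef.dotProduct_mulVec_nonneg v, h.det_pos.ne'⟩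
    · rintro ⟨h, hdet⟩
      exact (PosSemidef.of_dotProduct_mulVec_nonneg hx
        fun v => by simpa using h v).posDef_iff_det_ne_zero.2 hdet
  rw [h]
  refine MeasurableSet.inter (IsClosed.measurableSet ?_) (IsOpen.measurableSet ?_)
  · refine isClosed_iInter fun v => isClosed_le continuous_const ?_
    exact continuous_const.dotProduct (continuous_symMatrix.matrix_mulVec continuous_const)
  · exact isOpen_ne_fun continuous_symMatrix.matrix_det continuous_const

theorem setLIntegral_posDefCoords_succ {f : Matrix (Fin (p + 1)) (Fin (p + 1)) ℝ → ENNReal}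
    (hf : Measurable fun x => f (symMatrix x)) :
    ∫⁻ x in posDefCoords (p + 1), f (symMatrix x) =
      ∫⁻ y in posDefCoords p, ENNReal.ofReal (symMatrix y).det *
        ∫⁻ w : Fin p → ℝ, ∫⁻ t in Set.Ioi 0, f (schurMatrix t w (symMatrix y)) := by
  classical
  rw [← lintegral_indicator measurableSet_posDefCoords,
    ← lintegral_indicator measurableSet_posDefCoords,
    lintegral_upperIdx_succ (hf.indicator measurableSet_posDefCoords)]
  simp only [Set.indicator_apply, posDefCoords, Set.mem_ofPred_eq, symMatrix_upperEntries_border]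
  refine lintegral_congr fun y => ?_
  split_ifs with hy
  -- The substitution `b = C w` produces the Jacobian `|C|`.
  · rw [lintegral_mulVec hy.det_pos.ne', abs_of_pos hy.det_pos]
    congr 1
    refine lintegral_congr fun w => ?_
    -- Translating the corner entry by `wᵀ C w` turns it into the Schur complement.
    rw [← lintegral_indicator measurableSet_Ioi,
      ← lintegral_add_right_eq_self _ (w ⬝ᵥ symMatrix y *ᵥ w)]
    refine lintegral_congr fun t => ?_
    change (if (schurMatrix t w (symMatrix y)).PosDef then f (schurMatrix t w (symMatrix y))
      else 0) = _
    simp [Set.indicator_apply, posDef_schurMatrix_iff t w (symMatrix_isSymm y), hy]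
  · have h (b : Fin p → ℝ) (s : ℝ) : ¬ (border s b b (symMatrix y)).PosDef :=
      fun h => hy (h.submatrix (Fin.succ_injective p))
    simp [h]

end coordinates

/-! ### Gaussian and inverse gamma integrals -/

theorem lintegral_exp_neg_half_dotProduct (ι : Type*) [Fintype ι] :
    ∫⁻ x : ι → ℝ, ENNReal.ofReal (Real.exp (-(1 / 2) * (x ⬝ᵥ x))) =
      ENNReal.ofReal ((2 * Real.pi) ^ ((Fintype.card ι : ℝ) / 2)) := by
  have h (x : ι → ℝ) : Real.exp (-(1 / 2) * (x ⬝ᵥ x)) = ∏ i, Real.exp (-(1 / 2) * x i ^ 2) := by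
    rw [← Real.exp_sum, ← Finset.mul_sum]
    simp [dotProduct, sq]
  simp only [h]
  rw [← ofReal_integral_eq_lintegral_ofReal]
  · rw [integral_fintype_prod_volume_eq_pow fun x : ℝ => Real.exp (-(1 / 2) * x ^ 2),
      integral_gaussian, Real.sqrt_eq_rpow, ← Real.rpow_mul_natCast (by positivity)]
    congr 2
    · ring
    · ring
  · exact Integrable.fintype_prod fun _ => integrable_exp_neg_mul_sq (by norm_num)
  · exact ae_of_all _ fun x => Finset.prod_nonneg fun _ _ => (Real.exp_pos _).le

theorem lintegral_exp_neg_half_quadraticForm {ι : Type*} [Fintype ι] [DecidableEq ι]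
    {G : Matrix ι ι ℝ} (hG : G.PosDef) (x₀ : ι → ℝ) :
    ∫⁻ x : ι → ℝ, ENNReal.ofReal (Real.exp (-(1 / 2) * ((x - x₀) ⬝ᵥ G *ᵥ (x - x₀)))) =
      ENNReal.ofReal ((2 * Real.pi) ^ ((Fintype.card ι : ℝ) / 2) * G.det ^ (-(1 / 2) : ℝ)) := by
  rw [lintegral_sub_right_eq_self
    (fun x => ENNReal.ofReal (Real.exp (-(1 / 2) * (x ⬝ᵥ G *ᵥ x)))) x₀]
  obtain ⟨M, hM⟩ : ∃ M : Matrix ι ι ℝ, G = Mᵀ * M := by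
    open scoped MatrixOrder in
    obtain ⟨M, hM⟩ := CStarAlgebra.nonneg_iff_eq_star_mul_self.mp hG.posSemidef.nonneg
    exact ⟨M, by rw [hM, star_eq_conjTranspose, conjTranspose_eq_transpose_of_trivial]⟩
  have hdet : G.det = |M.det| ^ 2 := by rw [hM, det_mul, det_transpose, sq_abs, sq]
  have hM0 : M.det ≠ 0 := by
    intro h
    have := hG.det_pos
    simp [hdet, h] at this
  have hM1 : 0 < |M.det| := abs_pos.2 hM0
  have h := lintegral_exp_neg_half_dotProduct ι
  rw [lintegral_mulVec hM0] at h
  have h2 (x : ι → ℝ) : x ⬝ᵥ G *ᵥ x = M *ᵥ x ⬝ᵥ M *ᵥ x := by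
    rw [hM, ← mulVec_mulVec, dotProduct_mulVec, vecMul_transpose]
  have h3 : G.det ^ (-(1 / 2) : ℝ) = |M.det|⁻¹ := by
    rw [hdet, ← Real.rpow_natCast, ← Real.rpow_mul hM1.le, ← Real.rpow_neg_one]
    norm_num
  rw [h3, ENNReal.ofReal_mul (by positivity), ← h]
  simp only [h2]
  rw [mul_comm, ← mul_assoc, ← ENNReal.ofReal_mul (by positivity), inv_mul_cancel₀ hM1.ne']
  simp

theorem lintegral_rpow_mul_exp_neg_div {a r : ℝ} (ha : 0 < a) (hr : 0 < r) :
    ∫⁻ t in Set.Ioi 0, ENNReal.ofReal (t ^ (-a - 1) * Real.exp (-(r * t⁻¹))) =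
      ENNReal.ofReal (r ^ (-a) * Real.Gamma a) := by
  have hval := Real.integral_rpow_mul_exp_neg_mul_Ioi ha hr
  have hint : IntegrableOn (fun t : ℝ => t ^ (a - 1) * Real.exp (-(r * t))) (Set.Ioi 0) := by
    have := integrableOn_rpow_mul_exp_neg_mul_rpow (p := 1) (s := a - 1) (by linarith) one_pos hr
    simpa using this
  -- Substituting `t ↦ t⁻¹` reduces to the gamma integral.
  rw [← integral_comp_rpow_Ioi _ (by norm_num : (-1 : ℝ) ≠ 0)] at hval
  rw [← integrableOn_Ioi_comp_rpow_iff _ (by norm_num : (-1 : ℝ) ≠ 0)] at hint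
  have hcongr : Set.EqOn (fun t : ℝ => (|(-1 : ℝ)| * t ^ ((-1 : ℝ) - 1)) •
      ((t ^ (-1 : ℝ)) ^ (a - 1) * Real.exp (-(r * t ^ (-1 : ℝ)))))
      (fun t => t ^ (-a - 1) * Real.exp (-(r * t⁻¹))) (Set.Ioi 0) := by
    intro t ht
    have ht : 0 < t := ht
    simp only [smul_eq_mul, abs_neg, abs_one, one_mul]
    rw [← Real.rpow_mul ht.le, ← mul_assoc, ← Real.rpow_add ht, Real.rpow_neg_one]
    congr 2
    ring
  rw [setIntegral_congr_fun measurableSet_Ioi hcongr] at hval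
  rw [integrableOn_congr_fun hcongr measurableSet_Ioi] at hint
  rw [← ofReal_integral_eq_lintegral_ofReal hint, hval, one_div, Real.inv_rpow hr.le,
    Real.rpow_neg hr.le]
  filter_upwards [ae_restrict_mem measurableSet_Ioi] with t ht
  have ht : 0 < t := ht
  simp only [Pi.zero_apply]
  positivity

/-! ### The inverse Wishart integral -/

section inverseWishart

variable {p : ℕ}

/-- After swapping, the Gaussian in `w` has precision `t⁻¹ D` and contributes `t^{p/2}`, leaving an
inverse gamma integral of shape `m/2` and rate `b/2`. -/
theorem lintegral_lintegral_rpow_mul_exp_quadraticForm {m b : ℝ} (hm : 0 < m) (hb : 0 < b)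
    {D : Matrix (Fin p) (Fin p) ℝ} (hD : D.PosDef) (w₀ : Fin p → ℝ) :
    ∫⁻ w : Fin p → ℝ, ∫⁻ t in Set.Ioi 0, ENNReal.ofReal (t ^ (-((m + p) / 2) - 1) *
        Real.exp (-(1 / 2) * (t⁻¹ * (b + (w - w₀) ⬝ᵥ D *ᵥ (w - w₀))))) =
      ENNReal.ofReal ((2 * Real.pi) ^ ((p : ℝ) / 2) * D.det ^ (-(1 / 2) : ℝ) *
        ((b / 2) ^ (-(m / 2)) * Real.Gamma (m / 2))) := by
  have hq : Continuous fun z : (Fin p → ℝ) × ℝ => (z.1 - w₀) ⬝ᵥ D *ᵥ (z.1 - w₀) :=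
    (continuous_fst.sub continuous_const).dotProduct
      (continuous_const.matrix_mulVec (continuous_fst.sub continuous_const))
  have hmeas : Measurable fun z : (Fin p → ℝ) × ℝ => ENNReal.ofReal (z.2 ^ (-((m + p) / 2) - 1) *
      Real.exp (-(1 / 2) * (z.2⁻¹ * (b + (z.1 - w₀) ⬝ᵥ D *ᵥ (z.1 - w₀))))) := by
    have := hq.measurable
    fun_prop
  rw [lintegral_lintegral_swap hmeas.aemeasurable, ENNReal.ofReal_mul
    (mul_nonneg (by positivity) (Real.rpow_nonneg hD.det_pos.le _)),
    ← lintegral_rpow_mul_exp_neg_div (half_pos hm) (half_pos hb),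
    ← lintegral_const_mul' _ _ ENNReal.ofReal_ne_top]
  refine setLIntegral_congr_fun measurableSet_Ioi fun t ht => ?_
  have ht : 0 < t := ht
  have hG : (t⁻¹ • D).PosDef := hD.smul (inv_pos.2 ht)
  have h := lintegral_exp_neg_half_quadraticForm hG w₀
  have hsplit (w : Fin p → ℝ) : t ^ (-((m + p) / 2) - 1) *
      Real.exp (-(1 / 2) * (t⁻¹ * (b + (w - w₀) ⬝ᵥ D *ᵥ (w - w₀)))) =
      t ^ (-((m + p) / 2) - 1) * Real.exp (-(b / 2 * t⁻¹)) *
        Real.exp (-(1 / 2) * ((w - w₀) ⬝ᵥ (t⁻¹ • D) *ᵥ (w - w₀))) := by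
    rw [mul_assoc, ← Real.exp_add, smul_mulVec, dotProduct_smul, smul_eq_mul]
    congr 2
    ring
  have hpos : 0 ≤ t ^ (-((m + p) / 2) - 1) * Real.exp (-(b / 2 * t⁻¹)) := by positivity
  simp only [hsplit, ENNReal.ofReal_mul hpos]
  rw [lintegral_const_mul' _ _ ENNReal.ofReal_ne_top, h, ← ENNReal.ofReal_mul hpos,
    ← ENNReal.ofReal_mul (mul_nonneg (by positivity) (Real.rpow_nonneg hD.det_pos.le _))]
  congr 1
  rw [det_smul, Fintype.card_fin, Real.mul_rpow (by positivity) hD.det_pos.le,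
    ← Real.rpow_natCast, ← Real.rpow_mul (by positivity), Real.inv_rpow ht.le,
    ← Real.rpow_neg ht.le]
  have : t ^ (-(m / 2) - 1) = t ^ (-((m + p) / 2) - 1) * t ^ (-((p : ℝ) * (-(1 / 2)))) := by
    rw [← Real.rpow_add ht]
    congr 1
    ring
  rw [this]
  ring

theorem multivariateGamma_succ (a : ℝ) :
    multivariateGamma (p + 1) a =
      Real.pi ^ ((p : ℝ) / 2) * Real.Gamma a * multivariateGamma p (a - 1 / 2) := by
  have h : Real.pi ^ (((p + 1 : ℕ) : ℝ) * (((p + 1 : ℕ) : ℝ) - 1) / 4) =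
      Real.pi ^ ((p : ℝ) / 2) * Real.pi ^ ((p : ℝ) * ((p : ℝ) - 1) / 4) := by
    rw [← Real.rpow_add Real.pi_pos]
    congr 1
    push_cast
    ring
  have h2 (j : Fin p) : a - ((j.succ : ℕ) : ℝ) / 2 = a - 1 / 2 - ((j : ℕ) : ℝ) / 2 := by
    push_cast [Fin.val_succ]
    ring
  rw [multivariateGamma, multivariateGamma, h, Fin.prod_univ_succ]
  simp only [h2]
  simp
  ring

theorem multivariateGamma_pos {a : ℝ} (ha : ((p : ℝ) - 1) / 2 < a) :
    0 < multivariateGamma p a := by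
  refine mul_pos (by positivity) (Finset.prod_pos fun j _ => Real.Gamma_pos_of_pos ?_)
  have : ((j : ℕ) : ℝ) + 1 ≤ p := by exact_mod_cast j.2
  linarith

theorem measurable_inverseWishartKernel (B : Matrix (Fin p) (Fin p) ℝ) (s : ℝ) :
    Measurable fun x : UpperIdx p → ℝ => (symMatrix x).det ^ s *
      Real.exp (-(1 / 2) * (B * (symMatrix x)⁻¹).trace) := by
  have hdet : Continuous fun x : UpperIdx p → ℝ => (symMatrix x).det :=
    continuous_symMatrix.matrix_det
  have htr : Continuous fun x : UpperIdx p → ℝ => (B * (symMatrix x).adjugate).trace :=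
    (continuous_const.matrix_mul continuous_symMatrix.matrix_adjugate).matrix_trace
  -- The adjugate formula gives measurability at singular matrices too.
  simp only [Matrix.inv_def, Ring.inverse_eq_inv, Matrix.mul_smul, trace_smul, smul_eq_mul]
  have := hdet.measurable
  have := htr.measurable
  fun_prop

/-- The normalizing integral of the inverse Wishart distribution. -/
theorem setLIntegral_inverseWishartKernel (p : ℕ) {m : ℝ} (hm : (p : ℝ) - 1 < m)
    {B : Matrix (Fin p) (Fin p) ℝ} (hB : B.PosDef) :
    ∫⁻ x in posDefCoords p, ENNReal.ofReal ((symMatrix x).det ^ (-((m + p + 1) / 2)) *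
        Real.exp (-(1 / 2) * (B * (symMatrix x)⁻¹).trace)) =
      ENNReal.ofReal (2 ^ (m * p / 2) * multivariateGamma p (m / 2) * B.det ^ (-(m / 2))) := by
  induction p generalizing m with
  | zero =>
    -- The cone is a single point of mass one.
    have h (x : UpperIdx 0 → ℝ) : x ∈ posDefCoords 0 :=
      PosDef.of_dotProduct_mulVec_pos (Subsingleton.elim _ _)
        fun v hv => absurd (Subsingleton.elim _ _) hv
    have huniv : posDefCoords 0 = Set.univ := Set.eq_univ_of_forall h
    simp [huniv, multivariateGamma, Matrix.trace, volume_pi]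
  | succ p ih =>
    obtain ⟨b, w₀, D, hb, hD, rfl⟩ := exists_eq_schurMatrix hB
    push_cast at hm
    have hm0 : 0 < m := by linarith [(p.cast_nonneg : (0 : ℝ) ≤ p)]
    have hDd := hD.det_pos
    have hgam := (Real.Gamma_pos_of_pos (half_pos hm0)).le
    rw [setLIntegral_posDefCoords_succ
      (f := fun A : Matrix (Fin (p + 1)) (Fin (p + 1)) ℝ => ENNReal.ofReal
        (A.det ^ (-((m + (p + 1 : ℕ) + 1) / 2)) * Real.exp (-(1 / 2) * (schurMatrix b w₀ D * A⁻¹).trace)))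
      (measurable_inverseWishartKernel _ _).ennreal_ofReal]
    have hinner : ∀ y ∈ posDefCoords p,
        ENNReal.ofReal (symMatrix y).det * ∫⁻ w : Fin p → ℝ, ∫⁻ t in Set.Ioi 0, ENNReal.ofReal
          ((schurMatrix t w (symMatrix y)).det ^ (-((m + (p + 1 : ℕ) + 1) / 2)) *
            Real.exp (-(1 / 2) *
              (schurMatrix b w₀ D * (schurMatrix t w (symMatrix y))⁻¹).trace)) =
        ENNReal.ofReal ((2 * Real.pi) ^ ((p : ℝ) / 2) * D.det ^ (-(1 / 2) : ℝ) *
            ((b / 2) ^ (-(m / 2)) * Real.Gamma (m / 2))) *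
          ENNReal.ofReal ((symMatrix y).det ^ (-((m - 1 + p + 1) / 2)) *
            Real.exp (-(1 / 2) * (D * (symMatrix y)⁻¹).trace)) := by
      intro y hy
      have hC : (symMatrix y).PosDef := hy
      have hCd := hC.det_pos
      have hK : 0 ≤ (symMatrix y).det ^ (-((m + p) / 2) - 1) *
          Real.exp (-(1 / 2) * (D * (symMatrix y)⁻¹).trace) := by positivity
      have hker (w : Fin p → ℝ) : ∀ t ∈ Set.Ioi (0 : ℝ), ENNReal.ofReal
          ((schurMatrix t w (symMatrix y)).det ^ (-((m + (p + 1 : ℕ) + 1) / 2)) *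
            Real.exp (-(1 / 2) *
              (schurMatrix b w₀ D * (schurMatrix t w (symMatrix y))⁻¹).trace)) =
          ENNReal.ofReal ((symMatrix y).det ^ (-((m + p) / 2) - 1) *
            Real.exp (-(1 / 2) * (D * (symMatrix y)⁻¹).trace)) *
          ENNReal.ofReal (t ^ (-((m + p) / 2) - 1) *
            Real.exp (-(1 / 2) * (t⁻¹ * (b + (w - w₀) ⬝ᵥ D *ᵥ (w - w₀))))) := by
        intro t ht
        have ht : 0 < t := ht
        rw [det_schurMatrix t w hC.isSymm, trace_schurMatrix_mul_inv_schurMatrix t w hC.isSymm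
          ht.ne' hCd.ne'.isUnit b w₀ hD.isSymm, ← ENNReal.ofReal_mul hK,
          Real.mul_rpow ht.le hCd.le, mul_add, Real.exp_add]
        have he : -((m + (p + 1 : ℕ) + 1) / 2) = -((m + p) / 2) - 1 := by
          push_cast
          ring
        rw [he]
        congr 1
        ring
      have hinner (w : Fin p → ℝ) := setLIntegral_congr_fun (μ := volume) measurableSet_Ioi (hker w)
      simp only [hinner, lintegral_const_mul' _ _ ENNReal.ofReal_ne_top]
      rw [lintegral_lintegral_rpow_mul_exp_quadraticForm hm0 hb hD w₀, ← mul_assoc,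
        ← ENNReal.ofReal_mul hCd.le, mul_comm]
      congr 2
      rw [← mul_assoc]
      congr 1
      -- The Jacobian raises the power of `|C|` by one, to `-(m + p)/2 = -((m - 1) + p + 1)/2`:
      -- hence `m - 1` in the induction.
      conv_lhs => rw [← Real.rpow_one (symMatrix y).det]
      rw [← Real.rpow_mul hCd.le, ← Real.rpow_add hCd]
      congr 1
      ring
    rw [setLIntegral_congr_fun measurableSet_posDefCoords hinner,
      lintegral_const_mul' _ _ ENNReal.ofReal_ne_top, ih (by linarith) hD,
      ← ENNReal.ofReal_mul (by positivity)]
    congr 1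
    rw [multivariateGamma_succ, det_schurMatrix b w₀ hD.isSymm, Real.mul_rpow hb.le hDd.le,
      Real.div_rpow hb.le zero_le_two, Real.mul_rpow zero_le_two Real.pi_pos.le]
    have h2 : (2 : ℝ) ^ (m * ((p + 1 : ℕ) : ℝ) / 2) =
        2 ^ ((p : ℝ) / 2) * 2 ^ (m / 2) * 2 ^ ((m - 1) * p / 2) := by
      rw [← Real.rpow_add two_pos, ← Real.rpow_add two_pos]
      congr 1
      push_cast
      ring
    have hD2 : D.det ^ (-(m / 2)) = D.det ^ (-(1 / 2) : ℝ) * D.det ^ (-((m - 1) / 2)) := by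
      rw [← Real.rpow_add hDd]
      congr 1
      ring
    have h3 : (m - 1) / 2 = m / 2 - 1 / 2 := by ring
    rw [h2, hD2, Real.rpow_neg zero_le_two, h3]
    field_simp

end inverseWishart

/-! ### The modified inverse Wishart density -/

theorem mainTheorem5 {p : ℕ} (hp : 0 < p) (n : Fin p → ℝ) (hn : ∀ j, 0 < n j)
    (S : Matrix (Fin p) (Fin p) ℝ) (hS : S.PosDef) (v : ℝ)
    (hv : 2 * (p : ℝ) < 2 * v + (Matrix.diagonal n).trace / (p : ℝ)) :
    0 < miwConst S n v ∧ IsPosDefDensity (fun A => miwConst S n v * miwKernel S n v A) := by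
  have hp' : (0 : ℝ) < p := by exact_mod_cast hp
  set m : ℝ := 2 * v + (diagonal n).trace / (p : ℝ) - (p : ℝ) - 1 with hmdef
  have hm : (p : ℝ) - 1 < m := by linarith
  have hprod : 0 < ∏ j, n j := Finset.prod_pos fun j _ => hn j
  have hSd := hS.det_pos
  have hΓ : 0 < multivariateGamma p (m / 2) := multivariateGamma_pos (by linarith)
  set B := diagSqrt n * S * diagSqrt n with hBdef
  have hBdet : B.det = S.det * ∏ j, n j := by
    rw [hBdef, det_mul, det_mul, mul_right_comm, ← det_mul, diagSqrt_mul_self n hn, det_diagonal,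
      mul_comm]
  have hsqrt : (diagSqrt n)ᵀ = diagSqrt n := diagonal_transpose _
  have hB : B.PosDef := by
    have hU : IsUnit (diagSqrt n) := by
      rw [Matrix.isUnit_iff_isUnit_det, diagSqrt, det_diagonal]
      exact (Finset.prod_pos fun j _ => Real.sqrt_pos.2 (hn j)).ne'.isUnit
    have h := (Matrix.IsUnit.posDef_star_right_conjugate_iff hU).2 hS
    rwa [star_eq_conjTranspose, conjTranspose_eq_transpose_of_trivial, hsqrt] at h
  have hconst : miwConst S n v =
      (2 ^ (m * p / 2) * multivariateGamma p (m / 2) * B.det ^ (-(m / 2)))⁻¹ := by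
    rw [hBdet, Real.rpow_neg (by positivity), Real.mul_rpow hSd.le hprod.le, mul_inv, inv_inv,
      ← mul_assoc]
    rfl
  have hc : 0 < miwConst S n v := by
    have := hB.det_pos
    rw [hconst]
    positivity
  have hker (A : Matrix (Fin p) (Fin p) ℝ) : miwKernel S n v A =
      A.det ^ (-((m + p + 1) / 2)) * Real.exp (-(1 / 2) * (B * A⁻¹).trace) := by
    rw [miwKernel, etr, trace_smul, smul_eq_mul]
    congr 2
    rw [hmdef]
    field_simp
    ring
  have hnonneg (A : Matrix (Fin p) (Fin p) ℝ) (hA : A.PosDef) :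
      0 ≤ miwConst S n v * miwKernel S n v A := by
    have := hA.det_pos
    rw [hker]
    positivity
  have hae : 0 ≤ᵐ[volume.restrict (posDefCoords p)]
      fun x => miwConst S n v * miwKernel S n v (symMatrix x) := by
    filter_upwards [ae_restrict_mem measurableSet_posDefCoords] with x hx
    exact hnonneg _ hx
  have hmeas : Measurable fun x : UpperIdx p → ℝ =>
      miwConst S n v * miwKernel S n v (symMatrix x) := by
    simp only [hker]
    exact (measurable_inverseWishartKernel B _).const_mul _
  have hlint : ∫⁻ x in posDefCoords p,
      ENNReal.ofReal (miwConst S n v * miwKernel S n v (symMatrix x)) = 1 := by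
    simp only [hker, ENNReal.ofReal_mul hc.le]
    rw [lintegral_const_mul' _ _ ENNReal.ofReal_ne_top, setLIntegral_inverseWishartKernel p hm hB,
      ← ENNReal.ofReal_mul hc.le, hconst, inv_mul_cancel₀, ENNReal.ofReal_one]
    rw [hconst] at hc
    exact (inv_pos.1 hc).ne'
  -- Integrability and total mass both follow from the lower integral being one.
  refine ⟨hc, hnonneg, ⟨hmeas.aestronglyMeasurable, ?_⟩, ?_⟩
  · rw [hasFiniteIntegral_iff_ofReal hae, hlint]
    exact ENNReal.one_lt_top
  · rw [integral_eq_lintegral_of_nonneg_ae hae hmeas.aestronglyMeasurable, hlint]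
    rfl
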